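/- Let $n\ge 0$ and let $U$ be a unitary $2^n\times 2^n$ complex matrix, regarded as an operator on $n$ qubits with respect to the computational basis, whose entries all belong to the ring $\mathbb{Z}[\frac{1}{\sqrt2},i]\subseteq\mathbb{C}$ and such that $\det U=1$. Then $U$ can be exactly represented by a Clifford+$T$ circuit on $n$ qubits with no ancillas; that is, $U$ is equal, exactly and not merely up to a global phase, to a finite product of elementary gates on the $n$ qubits. Here the elementary gates are the scalar $\omega=e^{i\pi/4}$ (times the identity), the one-qubit gates $$H=\frac1{\sqrt2}\begin{pmatrix}1&1\\1&-1\end{pmatrix},\qquad S=\begin{pmatrix}1&0\\0&i\end{pmatrix},\qquad T=\begin{pmatrix}1&0\\0&e^{i\pi/4}\end{pmatrix},$$ each acting on an arbitrary one of the $n$ qubits, and the controlled-not gate $|a\rangle|b\rangle\mapsto|a\rangle|a\oplus b\rangle$ acting on an arbitrary ordered pair of distinct qubits, in each case with the identity on all other qubits. -/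

import Mathlib

noncomputable section

namespace CliffordT

/-- The ring `ℤ[1/√2, i]`, as a subring of the complex numbers. -/
def ringD : Subalgebra ℤ ℂ :=
  Algebra.adjoin ℤ {1 / ((Real.sqrt 2 : ℝ) : ℂ), Complex.I}

/-- The scalar `ω = e^{iπ/4}`. -/
def omega : ℂ := Complex.exp (Complex.I * Real.pi / 4)

/-- The computational basis of `n` qubits: the `2 ^ n` bit strings of length `n`. -/
abbrev Bits (n : ℕ) : Type := Fin n → Fin 2

/-- Operators on `n` qubits: the `2 ^ n × 2 ^ n` complex matrices, with rows and columns
labelled by the computational basis. -/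
abbrev Operator (n : ℕ) : Type := Matrix (Bits n) (Bits n) ℂ

/-- The Hadamard gate. -/
def matH : Matrix (Fin 2) (Fin 2) ℂ :=
  (1 / ((Real.sqrt 2 : ℝ) : ℂ)) • !![1, 1; 1, -1]

/-- The phase gate. -/
def matS : Matrix (Fin 2) (Fin 2) ℂ := !![1, 0; 0, Complex.I]

/-- The `T` gate. -/
def matT : Matrix (Fin 2) (Fin 2) ℂ := !![1, 0; 0, omega]

/-- The controlled-not gate on two qubits, `|a, b⟩ ↦ |a, a ⊕ b⟩` (the sum in `Fin 2` is modulo 2).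
The control is the first qubit and the target is the second one. -/
def matCNOT : Matrix (Fin 2 × Fin 2) (Fin 2 × Fin 2) ℂ :=
  Matrix.of fun x y => if x = (y.1, y.1 + y.2) then 1 else 0

/-- The one-qubit operator `A` applied to qubit `q` of `n` qubits, and the identity applied to the
other qubits. -/
def onQubit {n : ℕ} (q : Fin n) (A : Matrix (Fin 2) (Fin 2) ℂ) : Operator n :=
  Matrix.of fun x y => if ∀ j, j ≠ q → x j = y j then A (x q) (y q) else 0

/-- The two-qubit operator `A` applied to qubits `p` and `q` (in this order) of `n` qubits, and the
identity applied to the other qubits. Used for `p ≠ q` only. -/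
def onQubits {n : ℕ} (p q : Fin n) (A : Matrix (Fin 2 × Fin 2) (Fin 2 × Fin 2) ℂ) : Operator n :=
  Matrix.of fun x y =>
    if ∀ j, j ≠ p → j ≠ q → x j = y j then A (x p, x q) (y p, y q) else 0

/-- The elementary Clifford+`T` gates on `n` qubits: the scalar `ω`, the gates `H`, `S`, `T` on any
one qubit, and a controlled-not gate on any two distinct qubits. -/
inductive Gate (n : ℕ) : Type
  | scalar : Gate n
  | hadamard (q : Fin n) : Gate n
  | phase (q : Fin n) : Gate n
  | tgate (q : Fin n) : Gate n
  | cnot (control target : Fin n) (h : control ≠ target) : Gate n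

/-- The operator of an elementary gate. -/
def Gate.toOperator {n : ℕ} : Gate n → Operator n
  | .scalar => omega • (1 : Operator n)
  | .hadamard q => onQubit q matH
  | .phase q => onQubit q matS
  | .tgate q => onQubit q matT
  | .cnot c t _ => onQubits c t matCNOT

/-- A Clifford+`T` circuit on `n` qubits without ancillas: a finite sequence of elementary gates on
these `n` qubits. Inverse gates are not listed, since every elementary gate has finite order. -/
abbrev Circuit (n : ℕ) : Type := List (Gate n)

/-- The operator of a circuit, whose first gate is applied first. -/
def Circuit.toOperator {n : ℕ} : Circuit n → Operator n
  | [] => 1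
  | g :: C => Circuit.toOperator C * g.toOperator

/-- `U` is exactly represented by a Clifford+`T` circuit with no ancillas. The equation is one of
matrices: it is not up to a global phase. -/
def IsRepresentable {n : ℕ} (U : Operator n) : Prop :=
  ∃ C : Circuit n, C.toOperator = U

end CliffordT

end

noncomputable section

namespace CliffordT

open Matrix

/-! ### Scalars -/

/-! The proof reduces `U` column by column, using only two-level operators of determinant one.

No ancilla is needed because multiply controlled gates come from commutators: if `A` is controlled
by one set of qubits and `B` by another, on the same target, then the commutator of `A` and `B` acts
only where both controls fire. Since `iX` and `W = diag(ω⁻¹, ω)` have commutator `iZ`, and `H`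
conjugates `iZ` to `iX`, controls can be added one at a time (`isRepresentable_controlled_matIZ`).
Conjugation then gives fully controlled `iX`, `W` and `iH`, and basis permutations by CNOT and `X`
spread them to any two coordinates (`FullyControllable.realizable`).

A column is a unit vector over `ℤ[ω]` with denominator `√2 ^ k`. With the denominator cleared and `k
> 0`, its squared norm is even, so the entries not divisible by `√2` come in pairs of the same
residue type (`exists_pair_of_not_div`). One or two phased Hadamards make both entries of a pair
divisible by `√2` (`reaches_pair`), which lowers `k`. At `k = 0` the vector is a power of `ω` times
a basis vector, and `iX` and `W` bring it to the required basis vector (`reaches_single`).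

Iterating over columns (`isRepresentable_of_fixes`) leaves a diagonal operator with at most one
entry that could differ from `1`. Every step has determinant one, so that entry is `1` as well. -/

/-- The complex number `√2`. -/
def sqrtTwo : ℂ := ((Real.sqrt 2 : ℝ) : ℂ)

lemma sqrtTwo_mul_self : sqrtTwo * sqrtTwo = 2 := by
  unfold sqrtTwo
  rw [← Complex.ofReal_mul, Real.mul_self_sqrt (by norm_num)]
  norm_num

lemma sqrtTwo_ne_zero : sqrtTwo ≠ 0 := by
  intro h
  have := sqrtTwo_mul_self
  simp [h] at this

lemma star_sqrtTwo : star sqrtTwo = sqrtTwo := Complex.conj_ofReal _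

/-- The one place where the exponential is evaluated; the other identities for `ω` follow from this
one algebraically. -/
lemma sqrtTwo_mul_omega : sqrtTwo * omega = 1 + Complex.I := by
  have h : omega = Complex.exp (((Real.pi / 4 : ℝ) : ℂ) * Complex.I) := by
    unfold omega
    congr 1
    push_cast
    ring
  rw [h, Complex.exp_mul_I, ← Complex.ofReal_cos, ← Complex.ofReal_sin, Real.cos_pi_div_four,
    Real.sin_pi_div_four]
  have h2 := sqrtTwo_mul_self
  push_cast
  change sqrtTwo * (sqrtTwo / 2 + sqrtTwo / 2 * Complex.I) = _
  linear_combination (1 + Complex.I) / 2 * h2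

lemma omega_mul_self : omega * omega = Complex.I := by
  have h := sqrtTwo_mul_omega
  have h2 := sqrtTwo_mul_self
  have hI := Complex.I_mul_I
  linear_combination (-omega ^ 2 / 2) * h2 + (sqrtTwo * omega + 1 + Complex.I) / 2 * h + hI / 2

lemma omega_pow_four : omega ^ 4 = -1 := by
  linear_combination (omega * omega + Complex.I) * omega_mul_self + Complex.I_mul_I

lemma star_omega : star omega = -omega ^ 3 := by
  have h := congrArg star sqrtTwo_mul_omega
  have hI : star Complex.I = -Complex.I := Complex.conj_I
  rw [star_mul', star_sqrtTwo, star_add, star_one, hI] at h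
  apply mul_left_cancel₀ sqrtTwo_ne_zero
  linear_combination h + omega * omega * sqrtTwo_mul_omega + (1 + Complex.I) * omega_mul_self
    + Complex.I_mul_I

lemma sqrtTwo_eq : sqrtTwo = omega - omega ^ 3 := by
  linear_combination sqrtTwo * omega_pow_four - omega ^ 3 * sqrtTwo_mul_omega
    + omega ^ 3 * omega_mul_self - omega * omega_pow_four

/-! ### One-qubit matrices -/

/-- The Pauli matrix `X`. -/
def matX : Matrix (Fin 2) (Fin 2) ℂ := !![0, 1; 1, 0]

/-- The matrix `iZ`. -/
def matIZ : Matrix (Fin 2) (Fin 2) ℂ := !![Complex.I, 0; 0, -Complex.I]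

/-- The matrix `diag(ω⁻¹, ω)`. -/
def matW : Matrix (Fin 2) (Fin 2) ℂ := !![star omega, 0; 0, omega]

lemma matH_eq : matH = !![1 / sqrtTwo, 1 / sqrtTwo; 1 / sqrtTwo, -(1 / sqrtTwo)] := by
  unfold matH sqrtTwo
  ext i j
  fin_cases i <;> fin_cases j <;> simp

lemma star_matH : star matH = matH := by
  rw [matH_eq]
  have := star_sqrtTwo
  ext i j
  fin_cases i <;> fin_cases j <;> simp_all [Matrix.star_apply]

lemma matH_mul_self : matH * matH = 1 := by
  rw [matH_eq]
  have h := sqrtTwo_mul_self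
  have h0 := sqrtTwo_ne_zero
  ext i j
  fin_cases i <;> fin_cases j <;> simp [Matrix.mul_apply, Fin.sum_univ_two] <;> field_simp <;>
    linear_combination -h

lemma star_omega_mul : star omega * omega = 1 := by
  rw [star_omega]; linear_combination -omega_pow_four

lemma matT_mul_star : matT * star matT = 1 := by
  have h := star_omega_mul
  unfold matT
  ext i j
  fin_cases i <;> fin_cases j <;> simp [Matrix.mul_apply, Fin.sum_univ_two, Matrix.star_apply]
  exact (mul_comm _ _).trans h

lemma matT_mul_self : matT * matT = matS := by
  unfold matT matS
  ext i j
  fin_cases i <;> fin_cases j <;> simp [omega_mul_self]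

lemma matX_mul_self : matX * matX = 1 := by
  unfold matX
  ext i j
  fin_cases i <;> fin_cases j <;> simp

lemma star_matX : star matX = matX := by
  unfold matX
  ext i j
  fin_cases i <;> fin_cases j <;> simp [Matrix.star_apply]

lemma star_matT : star matT = !![1, 0; 0, -omega ^ 3] := by
  have := star_omega
  unfold matT
  ext i j
  fin_cases i <;> fin_cases j <;> simp_all [Matrix.star_apply]

/-- Replacing both factors `X` by CNOT makes the product a controlled `W`, because `T` and its
adjoint cancel when the control is off. -/
lemma matW_eq : matT * matX * star matT * matX = matW := by
  rw [star_matT, matW, star_omega]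
  unfold matT matX
  ext i j
  fin_cases i <;> fin_cases j <;> simp [Matrix.mul_apply, Fin.sum_univ_two]

lemma star_matW : star matW = !![omega, 0; 0, star omega] := by
  unfold matW
  ext i j
  fin_cases i <;> fin_cases j <;> simp [Matrix.star_apply]

lemma matW_mul_star : matW * star matW = 1 := by
  have h := star_omega_mul
  rw [star_matW]
  unfold matW
  ext i j
  fin_cases i <;> fin_cases j <;> simp [Matrix.mul_apply, Fin.sum_univ_two]
  · exact h
  · exact (mul_comm _ _).trans h

/-- The matrix `iX`. -/
def matIX : Matrix (Fin 2) (Fin 2) ℂ := !![0, Complex.I; Complex.I, 0]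

lemma matH_conj_matIZ : matH * matIZ * matH = matIX := by
  rw [matH_eq]
  have h := sqrtTwo_mul_self
  have h0 := sqrtTwo_ne_zero
  unfold matIZ matIX
  ext i j
  fin_cases i <;> fin_cases j <;> simp [Matrix.mul_apply, Fin.sum_univ_two] <;> field_simp <;>
    linear_combination -h

lemma star_matIX : star matIX = -matIX := by
  unfold matIX
  ext i j
  fin_cases i <;> fin_cases j <;> simp [Matrix.star_apply]

/-- Conjugation by `X` inverts `W`, so the commutator is `W⁻² = diag(i, -i)`. -/
lemma commutator_matIX_matW : matIX * matW * star matIX * star matW = matIZ := by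
  rw [star_matIX, star_matW]
  have h := omega_mul_self
  have h2 := star_omega_mul
  have h4 := omega_pow_four
  rw [star_omega] at *
  unfold matIX matW matIZ
  ext i j
  fin_cases i <;> fin_cases j <;> simp [Matrix.mul_apply, Fin.sum_univ_two]
  · linear_combination -omega ^ 2 * Complex.I_mul_I + h
  · rw [show (starRingEnd ℂ) omega = -omega ^ 3 from star_omega]
    linear_combination -omega ^ 6 * Complex.I_mul_I + omega ^ 2 * h4 - h

/-- The factor `i` cancels between `iX` and its adjoint, so this is `matW_eq` with a matrix of
determinant one in place of `X`. -/
lemma matIX_conj_matT : matT * matIX * star matT * star matIX = matW := by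
  rw [star_matIX, star_matT, matW, star_omega]
  have := Complex.I_mul_I
  unfold matT matIX
  ext i j
  fin_cases i <;> fin_cases j <;> simp [Matrix.mul_apply, Fin.sum_univ_two]
  · linear_combination omega ^ 3 * this
  · linear_combination -omega * this

/-- A Clifford+`T` operator that conjugates the Pauli matrix `Z` into `H`. -/
def matP : Matrix (Fin 2) (Fin 2) ℂ := matS * matH * matT * matH

/-- Up to the factor `i`, the successive conjugations by `H`, `T`, `H`, `S` take `Z` to `X`, `(X +
Y)/√2`, `(Z - Y)/√2` and `(Z + X)/√2 = H`. -/
lemma matP_conj_matIZ : matP * matIZ * star matP = Complex.I • matH := by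
  have h : matP * matIZ * star matP = matS * matH * matT * (matH * matIZ * matH) * star matT * matH
      * star matS := by
    simp only [matP, star_mul, star_matH, Matrix.mul_assoc]
  have hS : star matS = !![1, 0; 0, -Complex.I] := by
    unfold matS
    ext i j
    fin_cases i <;> fin_cases j <;> simp [Matrix.star_apply]
  have h1 := sqrtTwo_mul_self
  have h2 := omega_mul_self
  have h0 := sqrtTwo_ne_zero
  have hI3 : Complex.I ^ 3 = -Complex.I := by rw [pow_succ, Complex.I_sq]; ring
  have hX : matT * matIX * star matT = !![0, -Complex.I * omega ^ 3; Complex.I * omega, 0] := by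
    rw [star_matT]
    unfold matT matIX
    ext i j
    fin_cases i <;> fin_cases j <;> simp [Matrix.mul_apply, Fin.sum_univ_two]
    ring
  have h5 : omega = (1 + Complex.I) / sqrtTwo := by
    rw [← sqrtTwo_mul_omega]; field_simp
  have h6 : omega ^ 3 = Complex.I * (1 + Complex.I) / sqrtTwo := by
    rw [pow_succ, pow_two, h2]; nth_rw 1 [h5]; ring
  rw [h, matH_conj_matIZ, Matrix.mul_assoc (matS * matH), Matrix.mul_assoc (matS * matH), hX,
    hS, matH_eq, h6, h5, matS]
  ext i j
  fin_cases i <;> fin_cases j <;> simp [Matrix.mul_apply, Fin.sum_univ_two] <;> field_simp <;>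
    simp only [show sqrtTwo ^ 2 = 2 by rw [pow_two, h1], Complex.I_sq] <;> ring_nf <;>
    simp only [Complex.I_sq, hI3] <;>
    ring_nf

/-! ### Multiplexed one-qubit operators -/

section Mux

variable {n : ℕ}

/-- The bit strings of all qubits other than `q`. -/
abbrev Rest (q : Fin n) : Type := {j : Fin n // j ≠ q} → Fin 2

/-- The restriction of a bit string to the qubits other than `q`. -/
def rest (q : Fin n) (x : Bits n) : Rest q := fun j => x j

/-- The operator applying `F r` to the qubit `q` when the other qubits are in state `r`. -/
def mux (q : Fin n) : (Rest q → Matrix (Fin 2) (Fin 2) ℂ) →* Operator n where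
  toFun F := (blockDiagonal F).submatrix (Equiv.funSplitAt q (Fin 2)) (Equiv.funSplitAt q (Fin 2))
  map_one' := by simp
  map_mul' F G := by
    rw [submatrix_mul_equiv, ← blockDiagonal_mul]
    rfl

lemma mux_apply (q : Fin n) (F : Rest q → Matrix (Fin 2) (Fin 2) ℂ) (x y : Bits n) :
    mux q F x y = if rest q x = rest q y then F (rest q x) (x q) (y q) else 0 := by
  change blockDiagonal F _ _ = _
  rw [blockDiagonal_apply]
  rfl

lemma rest_eq_iff {q : Fin n} {x y : Bits n} :
    rest q x = rest q y ↔ ∀ j, j ≠ q → x j = y j := by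
  simp [rest, funext_iff]

lemma star_mux (q : Fin n) (F : Rest q → Matrix (Fin 2) (Fin 2) ℂ) :
    star (mux q F) = mux q (star F) := by
  change ((blockDiagonal F).submatrix _ _)ᴴ = _
  rw [conjTranspose_submatrix, blockDiagonal_conjTranspose]
  rfl

lemma det_mux (q : Fin n) (F : Rest q → Matrix (Fin 2) (Fin 2) ℂ) :
    (mux q F).det = ∏ r, (F r).det := by
  change ((blockDiagonal F).submatrix _ _).det = _
  rw [det_submatrix_equiv_self, det_blockDiagonal]

lemma mux_mulVec (q : Fin n) (F : Rest q → Matrix (Fin 2) (Fin 2) ℂ) (v : Bits n → ℂ)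
    (x : Bits n) :
    (mux q F *ᵥ v) x = ∑ b, F (rest q x) (x q) b * v (Function.update x q b) := by
  rw [mulVec, dotProduct, ← Equiv.sum_comp (Equiv.funSplitAt q (Fin 2)).symm,
    Fintype.sum_prod_type]
  refine Finset.sum_congr rfl fun b _ => ?_
  have h : ∀ r : Rest q, rest q ((Equiv.funSplitAt q (Fin 2)).symm (b, r)) = r := by
    intro r
    ext j
    simp [rest, Equiv.funSplitAt_symm_apply, j.2]
  have h' : (Equiv.funSplitAt q (Fin 2)).symm (b, rest q x) = Function.update x q b := by
    ext j
    by_cases hj : j = q <;> simp [Equiv.funSplitAt_symm_apply, hj, rest]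
  rw [Finset.sum_eq_single (rest q x)]
  · rw [mux_apply, h, if_pos rfl, h']
    simp
  · intro r _ hr
    rw [mux_apply, h, if_neg (Ne.symm hr), zero_mul]
  · simp

lemma onQubit_eq_mux (q : Fin n) (A : Matrix (Fin 2) (Fin 2) ℂ) :
    onQubit q A = mux q (fun _ => A) := by
  ext x y
  rw [mux_apply]
  simp only [rest_eq_iff, onQubit, of_apply]

lemma onQubits_matCNOT_eq_mux {c t : Fin n} (h : c ≠ t) :
    onQubits c t matCNOT = mux t (fun r => if r ⟨c, h⟩ = 1 then matX else 1) := by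
  ext x y
  rw [mux_apply]
  simp only [rest_eq_iff, onQubits, of_apply, matCNOT, Prod.mk.injEq]
  have key : ∀ a b a' b' : Fin 2, (if a = a' ∧ b = a' + b' then (1 : ℂ) else 0) =
      if a = a' then (if a = 1 then matX else 1) b b' else 0 := by
    intro a b a' b'
    unfold matX
    fin_cases a <;> fin_cases b <;> fin_cases a' <;> fin_cases b' <;> simp
  rw [key]
  by_cases h1 : ∀ j, j ≠ c → j ≠ t → x j = y j
  · rw [if_pos h1]
    by_cases h2 : x c = y c
    · have h3 : ∀ j, j ≠ t → x j = y j := by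
        intro j hj
        by_cases hc : j = c
        · rw [hc, h2]
        · exact h1 j hc hj
      rw [if_pos h2, if_pos h3]
      rfl
    · rw [if_neg h2, if_neg fun hh => h2 (hh c h)]
  · rw [if_neg h1, if_neg fun hh => h1 fun j _ hj => hh j hj]

end Mux

/-! ### Representable operators -/

section Representable

variable {n : ℕ}

lemma Circuit.toOperator_append (C D : Circuit n) :
    Circuit.toOperator (C ++ D) = Circuit.toOperator D * Circuit.toOperator C := by
  induction C with
  | nil => simp [Circuit.toOperator]
  | cons g C ih =>
    simp only [List.cons_append, Circuit.toOperator, ih, Matrix.mul_assoc]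

lemma isRepresentable_one : IsRepresentable (1 : Operator n) := ⟨[], rfl⟩

lemma IsRepresentable.mul {A B : Operator n} (hA : IsRepresentable A) (hB : IsRepresentable B) :
    IsRepresentable (A * B) := by
  obtain ⟨C, rfl⟩ := hA
  obtain ⟨D, rfl⟩ := hB
  exact ⟨D ++ C, Circuit.toOperator_append D C⟩

lemma Gate.isRepresentable (g : Gate n) : IsRepresentable g.toOperator :=
  ⟨[g], by simp [Circuit.toOperator]⟩

lemma IsRepresentable.pow {A : Operator n} (hA : IsRepresentable A) (k : ℕ) :
    IsRepresentable (A ^ k) := by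
  induction k with
  | zero => simpa using isRepresentable_one
  | succ k ih => rw [pow_succ]; exact ih.mul hA

lemma matT_pow_eight : matT ^ 8 = 1 := by
  have h : matT = Matrix.diagonal ![1, omega] := by
    unfold matT
    ext i j
    fin_cases i <;> fin_cases j <;> simp
  have h8 : omega ^ 8 = 1 := by linear_combination (omega ^ 4 - 1) * omega_pow_four
  rw [h, Matrix.diagonal_pow]
  ext i j
  fin_cases i <;> fin_cases j <;> simp [h8]

/-- The gates have orders dividing 8, so the adjoint of a gate is its seventh power and circuits
need no inverse gates. -/
lemma Gate.pow_eight (g : Gate n) : g.toOperator ^ 8 = 1 := by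
  cases g with
  | scalar =>
    have h8 : omega ^ 8 = 1 := by linear_combination (omega ^ 4 - 1) * omega_pow_four
    simp only [Gate.toOperator, smul_pow, one_pow, h8, one_smul]
  | hadamard q =>
    simp only [Gate.toOperator, onQubit_eq_mux]
    rw [← map_pow, show (8 : ℕ) = 2 * 4 from rfl, pow_mul, pow_two]
    convert map_one (mux q)
    ext1 r
    simp [matH_mul_self]
  | phase q =>
    simp only [Gate.toOperator, onQubit_eq_mux]
    rw [← map_pow]
    convert map_one (mux q)
    ext1 r
    simp only [Pi.pow_apply, Pi.one_apply]
    rw [← matT_mul_self, ← pow_two, ← pow_mul, mul_comm, pow_mul, matT_pow_eight, one_pow]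
  | tgate q =>
    simp only [Gate.toOperator, onQubit_eq_mux]
    rw [← map_pow]
    convert map_one (mux q)
    ext1 r
    simp [matT_pow_eight]
  | cnot c t h =>
    simp only [Gate.toOperator, onQubits_matCNOT_eq_mux h]
    rw [← map_pow, show (8 : ℕ) = 2 * 4 from rfl, pow_mul, pow_two]
    convert map_one (mux t)
    ext1 r
    simp only [Pi.pow_apply, Pi.mul_apply, Pi.one_apply]
    split_ifs <;> simp [matX_mul_self]

lemma star_matS_mul : matS * star matS = 1 := by
  rw [← matT_mul_self, star_mul, Matrix.mul_assoc, ← Matrix.mul_assoc matT (star matT),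
    matT_mul_star, Matrix.one_mul, matT_mul_star]

lemma mux_mul_star {q : Fin n} {F : Rest q → Matrix (Fin 2) (Fin 2) ℂ}
    (h : ∀ r, F r * star (F r) = 1) : mux q F * star (mux q F) = 1 := by
  rw [star_mux, ← map_mul]
  convert map_one (mux q)
  ext1 r
  exact h r

lemma Gate.mem_unitary (g : Gate n) : g.toOperator * star g.toOperator = 1 := by
  cases g with
  | scalar =>
    simp only [Gate.toOperator, star_smul, star_one, smul_mul_smul_comm, mul_one]
    rw [mul_comm, star_omega_mul, one_smul]
  | hadamard q =>
    simp only [Gate.toOperator, onQubit_eq_mux]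
    exact mux_mul_star fun _ => by rw [star_matH, matH_mul_self]
  | phase q =>
    simp only [Gate.toOperator, onQubit_eq_mux]
    exact mux_mul_star fun _ => star_matS_mul
  | tgate q =>
    simp only [Gate.toOperator, onQubit_eq_mux]
    exact mux_mul_star fun _ => matT_mul_star
  | cnot c t h =>
    simp only [Gate.toOperator, onQubits_matCNOT_eq_mux h]
    refine mux_mul_star fun r => ?_
    split_ifs
    · rw [star_matX, matX_mul_self]
    · simp

lemma IsRepresentable.mem_unitaryGroup {A : Operator n} (hA : IsRepresentable A) :
    A ∈ Matrix.unitaryGroup (Bits n) ℂ := by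
  obtain ⟨C, rfl⟩ := hA
  induction C with
  | nil => exact one_mem _
  | cons g C ih => exact mul_mem ih (mem_unitaryGroup_iff.2 g.mem_unitary)

lemma IsRepresentable.star {A : Operator n} (hA : IsRepresentable A) :
    IsRepresentable (star A) := by
  obtain ⟨C, rfl⟩ := hA
  induction C with
  | nil => simpa [Circuit.toOperator] using isRepresentable_one
  | cons g C ih =>
    rw [Circuit.toOperator, star_mul]
    refine IsRepresentable.mul ?_ ih
    have h : Star.star g.toOperator = g.toOperator ^ 7 := by
      calc Star.star g.toOperator = g.toOperator ^ 8 * Star.star g.toOperator := by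
            rw [g.pow_eight, one_mul]
        _ = _ := by rw [pow_succ, Matrix.mul_assoc, g.mem_unitary, mul_one]
    rw [h]
    exact g.isRepresentable.pow 7

lemma isRepresentable_matH (q : Fin n) : IsRepresentable (mux q fun _ => matH) := by
  rw [← onQubit_eq_mux]; exact (Gate.hadamard q).isRepresentable

lemma isRepresentable_matT (q : Fin n) : IsRepresentable (mux q fun _ => matT) := by
  rw [← onQubit_eq_mux]; exact (Gate.tgate q).isRepresentable

lemma isRepresentable_matS (q : Fin n) : IsRepresentable (mux q fun _ => matS) := by
  rw [← onQubit_eq_mux]; exact (Gate.phase q).isRepresentable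

lemma isRepresentable_cnot {c t : Fin n} (h : c ≠ t) :
    IsRepresentable (mux t fun r => if r ⟨c, h⟩ = 1 then matX else 1) := by
  rw [← onQubits_matCNOT_eq_mux h]; exact (Gate.cnot c t h).isRepresentable

lemma matH_conj_matS : matH * (matS * matS) * matH = matX := by
  rw [matH_eq]
  have h := sqrtTwo_mul_self
  have h0 := sqrtTwo_ne_zero
  unfold matS matX
  ext i j
  fin_cases i <;> fin_cases j <;> simp [Matrix.mul_apply, Fin.sum_univ_two] <;> field_simp <;>
    linear_combination -h

/-- Products and adjoints of multiplexed operators, evaluated blockwise. -/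
lemma IsRepresentable.mux_mul {q : Fin n} {F G : Rest q → Matrix (Fin 2) (Fin 2) ℂ}
    (hF : IsRepresentable (mux q F)) (hG : IsRepresentable (mux q G)) :
    IsRepresentable (mux q fun r => F r * G r) := by
  have := hF.mul hG
  rwa [← map_mul] at this

lemma IsRepresentable.mux_star {q : Fin n} {F : Rest q → Matrix (Fin 2) (Fin 2) ℂ}
    (hF : IsRepresentable (mux q F)) : IsRepresentable (mux q fun r => Star.star (F r)) := by
  have := hF.star
  rwa [star_mux] at this

lemma isRepresentable_matX (q : Fin n) : IsRepresentable (mux q fun _ => matX) := by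
  rw [← matH_conj_matS]
  exact ((isRepresentable_matH q).mux_mul
    ((isRepresentable_matS q).mux_mul (isRepresentable_matS q))).mux_mul (isRepresentable_matH q)

lemma isRepresentable_matW (q : Fin n) : IsRepresentable (mux q fun _ => matW) := by
  rw [← matW_eq]
  exact (((isRepresentable_matT q).mux_mul (isRepresentable_matX q)).mux_mul
    (isRepresentable_matT q).mux_star).mux_mul (isRepresentable_matX q)

lemma isRepresentable_controlled_matW {c t : Fin n} (h : c ≠ t) (b : Fin 2) :
    IsRepresentable (mux t fun r => if r ⟨c, h⟩ = b then matW else 1) := by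
  have h1 : IsRepresentable (mux t fun r => if r ⟨c, h⟩ = 1 then matW else 1) := by
    have := (((isRepresentable_matT t).mux_mul (isRepresentable_cnot h)).mux_mul
      (isRepresentable_matT t).mux_star).mux_mul (isRepresentable_cnot h)
    convert this using 3 with r
    split_ifs
    · exact matW_eq.symm
    · rw [Matrix.mul_one, Matrix.mul_one, matT_mul_star]
  obtain rfl | rfl : b = 0 ∨ b = 1 := by omega
  · convert (isRepresentable_matW t).mux_mul h1.mux_star using 3 with r
    by_cases hr : r ⟨c, h⟩ = 1
    · simp [hr, matW_mul_star]
    · have : r ⟨c, h⟩ = 0 := by omega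
      simp [this]
  · exact h1

/-- The operator `matIZ` on a qubit, controlled by any set of other qubits. -/
lemma isRepresentable_controlled_matIZ (q : Fin n) (r₀ : Rest q)
    (s : Finset {j : Fin n // j ≠ q}) :
    IsRepresentable (mux q fun r => if ∀ j ∈ s, r j = r₀ j then matIZ else 1) := by
  induction s using Finset.induction_on with
  | empty =>
    have hX : IsRepresentable (mux q fun _ => matIX) := by
      have h : matIX = matS * matX * matS := by
        unfold matIX matS matX
        ext i j
        fin_cases i <;> fin_cases j <;> simp
      rw [h]
      exact ((isRepresentable_matS q).mux_mul (isRepresentable_matX q)).mux_mul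
        (isRepresentable_matS q)
    have := ((hX.mux_mul (isRepresentable_matW q)).mux_mul hX.mux_star).mux_mul
      (isRepresentable_matW q).mux_star
    simpa [commutator_matIX_matW] using this
  | insert c s hc ih =>
    -- `H` turns `iZ` controlled by `s` into `iX` controlled by `s`, since `H * H = 1` where the
    -- control is off. Its commutator with `W` controlled by `c` is trivial unless both controls
    -- fire.
    have hX := ((isRepresentable_matH q).mux_mul ih).mux_mul (isRepresentable_matH q)
    have hW := isRepresentable_controlled_matW c.2 (r₀ c)
    convert ((hX.mux_mul hW).mux_mul hX.mux_star).mux_mul hW.mux_star using 3 with r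
    by_cases h1 : ∀ j ∈ s, r j = r₀ j
    · by_cases h2 : r c = r₀ c
      · rw [if_pos h1, if_pos h2,
          if_pos (Finset.forall_mem_insert c s (fun j => r j = r₀ j) |>.2 ⟨h2, h1⟩), matH_conj_matIZ,
          commutator_matIX_matW]
      · rw [if_pos h1, if_neg h2, if_neg fun h => h2 (h c (Finset.mem_insert_self c s)),
          matH_conj_matIZ, star_one, Matrix.mul_one, Matrix.mul_one, star_matIX]
        unfold matIX
        ext i j
        fin_cases i <;> fin_cases j <;> simp
    · rw [if_neg h1, if_neg fun h => h1 fun j hj => h j (Finset.mem_insert_of_mem hj)]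
      simp only [Matrix.mul_one, matH_mul_self, star_one]
      split_ifs
      · simp [matW_mul_star]
      · simp

end Representable

section

/-! ### Two-level operators -/

/-- A matrix of determinant one all of whose fully controlled versions are representable. -/
def FullyControllable (g : Matrix (Fin 2) (Fin 2) ℂ) : Prop :=
  g.det = 1 ∧ ∀ (n : ℕ) (q : Fin n) (r₀ : Rest q),
    IsRepresentable (mux q fun r => if r = r₀ then g else 1)

lemma fullyControllable_matIZ : FullyControllable matIZ := by
  refine ⟨by simp [matIZ, det_fin_two], fun n q r₀ => ?_⟩
  convert isRepresentable_controlled_matIZ q r₀ Finset.univ using 5 with r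
  simp [funext_iff]

lemma FullyControllable.mul {g h : Matrix (Fin 2) (Fin 2) ℂ} (hg : FullyControllable g)
    (hh : FullyControllable h) : FullyControllable (g * h) := by
  refine ⟨by rw [det_mul, hg.1, hh.1, one_mul], fun n q r₀ => ?_⟩
  convert (hg.2 n q r₀).mux_mul (hh.2 n q r₀) using 3 with r
  split_ifs <;> simp

lemma FullyControllable.star {g : Matrix (Fin 2) (Fin 2) ℂ} (hg : FullyControllable g) :
    FullyControllable (star g) := by
  refine ⟨by rw [star_eq_conjTranspose, det_conjTranspose, hg.1, star_one], fun n q r₀ => ?_⟩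
  convert (hg.2 n q r₀).mux_star using 3 with r
  split_ifs <;> simp

/-- `A` itself needs no control: in the blocks where `g` is not applied it cancels against its
adjoint. -/
lemma FullyControllable.conj {g A : Matrix (Fin 2) (Fin 2) ℂ} (hg : FullyControllable g)
    (hA : A * Star.star A = 1) (h : ∀ (n : ℕ) (q : Fin n), IsRepresentable (mux q fun _ => A)) :
    FullyControllable (A * g * Star.star A) := by
  refine ⟨?_, fun n q r₀ => ?_⟩
  · rw [det_mul, det_mul, hg.1, mul_one, ← det_mul, hA, det_one]
  · convert ((h n q).mux_mul (hg.2 n q r₀)).mux_mul (h n q).mux_star using 3 with r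
    split_ifs <;> simp [hA]

lemma fullyControllable_matIX : FullyControllable matIX := by
  rw [← matH_conj_matIZ]
  have := fullyControllable_matIZ.conj (A := matH) (by rw [star_matH, matH_mul_self])
    fun _ q => isRepresentable_matH q
  rwa [star_matH] at this

lemma fullyControllable_matW : FullyControllable matW := by
  rw [← matIX_conj_matT]
  exact (fullyControllable_matIX.conj matT_mul_star fun _ q => isRepresentable_matT q).mul
    fullyControllable_matIX.star

lemma FullyControllable.pow {g : Matrix (Fin 2) (Fin 2) ℂ} (hg : FullyControllable g) (k : ℕ) :
    FullyControllable (g ^ k) := by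
  induction k with
  | zero =>
    refine ⟨by simp, fun n q r₀ => ?_⟩
    convert isRepresentable_one (n := n)
    convert map_one (mux q)
    simp
  | succ k ih => rw [pow_succ]; exact ih.mul hg

lemma fullyControllable_I_smul_matH : FullyControllable (Complex.I • matH) := by
  rw [← matP_conj_matIZ]
  refine fullyControllable_matIZ.conj ?_ fun n q => ?_
  · simp only [matP, star_mul, star_matH, Matrix.mul_assoc]
    rw [← Matrix.mul_assoc matH matH, matH_mul_self, Matrix.one_mul,
      ← Matrix.mul_assoc matT (Star.star matT), matT_mul_star, Matrix.one_mul,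
      ← Matrix.mul_assoc matH matH, matH_mul_self, Matrix.one_mul, star_matS_mul]
  · exact (((isRepresentable_matS q).mux_mul (isRepresentable_matH q)).mux_mul
      (isRepresentable_matT q)).mux_mul (isRepresentable_matH q)

/-- Applied to `iH`, this inserts the phase `ω ^ m` on the second entry before the two entries are
added and subtracted. -/
lemma FullyControllable.conj_matT_pow {g : Matrix (Fin 2) (Fin 2) ℂ} (hg : FullyControllable g)
    (m : ℕ) : FullyControllable (Star.star matT ^ m * g * matT ^ m) := by
  induction m generalizing g with
  | zero => simpa using hg
  | succ m ih =>
    have h : Star.star matT * matT = 1 := mul_eq_one_comm.1 matT_mul_star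
    have := ih (hg.conj (A := Star.star matT) (by rwa [star_star])
      fun _ q => (isRepresentable_matT q).mux_star)
    rw [star_star] at this
    rw [pow_succ, pow_succ']
    simpa only [Matrix.mul_assoc] using this

variable {ι : Type*} [DecidableEq ι]

/-- The two-level operator that acts as `g` on the coordinates `x` and `y` of a vector. -/
def twoLevel (g : Matrix (Fin 2) (Fin 2) ℂ) (x y : ι) (v : ι → ℂ) : ι → ℂ := fun z =>
  if z = x then g 0 0 * v x + g 0 1 * v y else if z = y then g 1 0 * v x + g 1 1 * v y else v z

/-- There is a representable operator of determinant one that acts on vectors as the function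
`f`. -/
def Realizable {n : ℕ} (f : (Bits n → ℂ) → Bits n → ℂ) : Prop :=
  ∃ M : Operator n, IsRepresentable M ∧ M.det = 1 ∧ ∀ v, M *ᵥ v = f v

lemma twoLevel_permute {g : Matrix (Fin 2) (Fin 2) ℂ} {x y : ι} {v : ι → ℂ} {σ : ι → ι}
    (hσ : ∀ z, σ (σ z) = z) :
    twoLevel g (σ x) (σ y) (v ∘ σ) ∘ σ = twoLevel g x y v := by
  have hi : ∀ a b, σ a = σ b ↔ a = b := fun a b =>
    ⟨fun h => by rw [← hσ a, h, hσ], fun h => by rw [h]⟩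
  ext z
  simp [twoLevel, hi, hσ]

variable {n : ℕ}

/-- `P` is an involution, so `P * M * P` is a conjugate of `M` and has determinant one whatever the
determinant of `P`. -/
lemma Realizable.of_permute {g : Matrix (Fin 2) (Fin 2) ℂ} {x y : Bits n} {σ : Bits n → Bits n}
    (hσ : ∀ z, σ (σ z) = z) {P : Operator n} (hP : IsRepresentable P)
    (hPσ : ∀ v : Bits n → ℂ, P *ᵥ v = v ∘ σ) (h : Realizable (twoLevel g (σ x) (σ y))) :
    Realizable (twoLevel g x y) := by
  obtain ⟨M, hM, hd, hv⟩ := h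
  have hPP : P * P = 1 := by
    refine Matrix.ext_of_mulVec_single fun i => ?_
    rw [← mulVec_mulVec, hPσ, hPσ, one_mulVec]
    ext z
    simp [hσ]
  refine ⟨P * M * P, (hP.mul hM).mul hP, ?_, fun v => ?_⟩
  · rw [det_mul, det_mul, hd, mul_one, ← det_mul, hPP, det_one]
  · rw [← mulVec_mulVec, ← mulVec_mulVec, hPσ, hv, hPσ, twoLevel_permute hσ]

lemma mulVec_cnot {c t : Fin n} (h : c ≠ t) (v : Bits n → ℂ) :
    (mux t fun r => if r ⟨c, h⟩ = 1 then matX else 1) *ᵥ v =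
      v ∘ fun z => Function.update z t (z c + z t) := by
  ext z
  rw [mux_mulVec, Fin.sum_univ_two]
  have hz : rest t z ⟨c, h⟩ = z c := rfl
  rw [hz, Function.comp_apply]
  unfold matX
  generalize z c = a
  generalize z t = b
  obtain rfl | rfl : a = 0 ∨ a = 1 := by omega
  all_goals obtain rfl | rfl : b = 0 ∨ b = 1 := by omega
  all_goals simp

lemma mulVec_matX (q : Fin n) (v : Bits n → ℂ) :
    (mux q fun _ => matX) *ᵥ v = v ∘ fun z => Function.update z q (1 + z q) := by
  ext z
  rw [mux_mulVec, Fin.sum_univ_two, Function.comp_apply]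
  unfold matX
  generalize z q = b
  fin_cases b <;> simp

lemma FullyControllable.realizable_of_update {g : Matrix (Fin 2) (Fin 2) ℂ}
    (hg : FullyControllable g) (q : Fin n) (x : Bits n) (hx : x q = 0) :
    Realizable (twoLevel g x (Function.update x q 1)) := by
  refine ⟨_, hg.2 n q (rest q x), ?_, fun v => ?_⟩
  · rw [det_mux]
    refine Finset.prod_eq_one fun r _ => ?_
    split_ifs
    · exact hg.1
    · exact det_one
  · ext z
    rw [mux_mulVec, Fin.sum_univ_two]
    by_cases h : rest q z = rest q x
    · have hz : ∀ b, Function.update z q b = Function.update x q b := by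
        intro b
        ext j
        by_cases hj : j = q
        · subst hj; simp
        · simp [hj, rest_eq_iff.1 h j hj]
      have hzz : z = Function.update x q (z q) := by rw [← hz, Function.update_eq_self]
      have hx0 : Function.update x q 0 = x := by rw [← hx, Function.update_eq_self]
      have hne : Function.update x q 1 ≠ x := fun hh => by
        have := congrFun hh q
        simp [hx] at this
      rw [if_pos h, hz, hz, hx0]
      obtain hb | hb : z q = 0 ∨ z q = 1 := by omega
      · rw [hb, hx0] at hzz
        simp [twoLevel, hzz, hx]
      · rw [hb] at hzz
        simp [twoLevel, hzz, hne]
    · have h1 : z ≠ x := fun hh => h (by rw [hh])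
      have h2 : z ≠ Function.update x q 1 := by
        rintro rfl
        exact h (rest_eq_iff.2 fun j hj => by simp [hj])
      rw [if_neg h]
      simp only [twoLevel, if_neg h1, if_neg h2]
      have hz := Function.update_eq_self q z
      obtain hb | hb : z q = 0 ∨ z q = 1 := by omega
      all_goals
        rw [hb] at hz ⊢
        simp [hz]

theorem FullyControllable.realizable {g : Matrix (Fin 2) (Fin 2) ℂ} (hg : FullyControllable g)
    {x y : Bits n} (hxy : x ≠ y) : Realizable (twoLevel g x y) := by
  induction hk : (Finset.univ.filter fun j => x j ≠ y j).card using Nat.strong_induction_on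
    generalizing x y with
  | _ k ih =>
    obtain ⟨q, hq⟩ := Function.ne_iff.1 hxy
    by_cases h1 : ∃ t, q ≠ t ∧ x t ≠ y t
    · obtain ⟨t, hqt, ht⟩ := h1
      -- Exactly one of `x q`, `y q` is `1`, so a CNOT from `q` to `t` flips the bit `t` in exactly
      -- one of `x`, `y`. They then agree at `t` and still differ at `q`, so the Hamming distance
      -- drops.
      refine Realizable.of_permute (σ := fun z => Function.update z t (z q + z t)) (fun z => ?_)
        (isRepresentable_cnot hqt) (mulVec_cnot hqt) (ih _ ?_ ?_ rfl)
      · ext j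
        by_cases hj : j = t
        · subst hj; simp [hqt]; omega
        · simp [hj]
      · rw [← hk]
        refine Finset.card_lt_card (Finset.ssubset_iff_of_subset ?_ |>.2 ⟨t, by simp [ht], ?_⟩)
        · intro j
          by_cases hj : j = t
          · subst hj; simp [ht]
          · simp [hj]
        · simp; omega
      · intro hh
        have := congrFun hh q
        simp [hqt] at this
        exact hq this
    · push Not at h1
      have key : ∀ x y : Bits n, x q = 0 → y q = 1 → (∀ t, q ≠ t → x t = y t) →
          Realizable (twoLevel g x y) := by
        intro x y hx hy h
        convert hg.realizable_of_update q x hx using 2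
        ext j
        by_cases hj : j = q
        · subst hj; simp [hy]
        · simp [hj, h j (Ne.symm hj)]
      by_cases hx : x q = 0
      · exact key x y hx (by omega) h1
      · refine Realizable.of_permute (σ := fun z => Function.update z q (1 + z q)) (fun z => ?_)
          (isRepresentable_matX q) (mulVec_matX q) (key _ _ ?_ ?_ ?_)
        · ext j
          by_cases hj : j = q
          · subst hj; simp; omega
          · simp [hj]
        · simp; omega
        · simp; omega
        · intro t ht
          simp [Ne.symm ht, h1 t ht]

end

/-! ### The ring `ℤ[ω]` -/

/-- The element of `ℤ[ω]` with given coordinates in the basis `1, ω, ω², ω³`. -/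
def cyc (a b c d : ℤ) : ℂ := a + b * omega + c * omega ^ 2 + d * omega ^ 3

lemma cyc_add (a b c d a' b' c' d' : ℤ) :
    cyc a b c d + cyc a' b' c' d' = cyc (a + a') (b + b') (c + c') (d + d') := by
  simp only [cyc]; push_cast; ring

lemma cyc_neg (a b c d : ℤ) : -cyc a b c d = cyc (-a) (-b) (-c) (-d) := by
  simp only [cyc]; push_cast; ring

lemma omega_mul_cyc (a b c d : ℤ) : omega * cyc a b c d = cyc (-d) a b c := by
  simp only [cyc]; push_cast; linear_combination d * omega_pow_four

lemma cyc_mul (a b c d a' b' c' d' : ℤ) : cyc a b c d * cyc a' b' c' d' =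
    cyc (a * a' - b * d' - c * c' - d * b') (a * b' + b * a' - c * d' - d * c')
      (a * c' + b * b' + c * a' - d * d') (a * d' + b * c' + c * b' + d * a') := by
  simp only [cyc]; push_cast
  linear_combination (b * d' + c * c' + d * b' + (c * d' + d * c') * omega + d * d' * omega ^ 2)
    * omega_pow_four

lemma sqrtTwo_mul_cyc (a b c d : ℤ) :
    sqrtTwo * cyc a b c d = cyc (b - d) (a + c) (b + d) (c - a) := by
  have h : sqrtTwo = cyc 0 1 0 (-1) := by rw [sqrtTwo_eq]; simp [cyc]; ring
  rw [h, cyc_mul]; congr 1 <;> ring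

/-- The ring `ℤ[ω]`. -/
def ringZ : Subring ℂ where
  carrier := {z | ∃ a b c d, z = cyc a b c d}
  zero_mem' := ⟨0, 0, 0, 0, by simp [cyc]⟩
  one_mem' := ⟨1, 0, 0, 0, by simp [cyc]⟩
  add_mem' := by
    rintro _ _ ⟨a, b, c, d, rfl⟩ ⟨a', b', c', d', rfl⟩
    exact ⟨_, _, _, _, cyc_add ..⟩
  neg_mem' := by
    rintro _ ⟨a, b, c, d, rfl⟩
    exact ⟨_, _, _, _, cyc_neg ..⟩
  mul_mem' := by
    rintro _ _ ⟨a, b, c, d, rfl⟩ ⟨a', b', c', d', rfl⟩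
    exact ⟨_, _, _, _, cyc_mul ..⟩

lemma omega_mem_ringZ : omega ∈ ringZ := ⟨0, 1, 0, 0, by simp [cyc]⟩

lemma sqrtTwo_mem_ringZ : sqrtTwo ∈ ringZ := by
  rw [sqrtTwo_eq]; exact sub_mem omega_mem_ringZ (pow_mem omega_mem_ringZ 3)

lemma I_mem_ringZ : Complex.I ∈ ringZ := by
  rw [← omega_mul_self]; exact mul_mem omega_mem_ringZ omega_mem_ringZ

lemma star_omega_mem_ringZ : star omega ∈ ringZ := by
  rw [star_omega]; exact neg_mem (pow_mem omega_mem_ringZ 3)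

/-- Every element of `ℤ[1/√2, i]` has a denominator that is a power of `√2`. -/
lemma exists_pow_mul_mem_ringZ {z : ℂ} (hz : z ∈ ringD) : ∃ k : ℕ, sqrtTwo ^ k * z ∈ ringZ := by
  induction hz using Algebra.adjoin_induction with
  | mem x hx =>
    rcases hx with rfl | rfl
    · refine ⟨1, ?_⟩
      change sqrtTwo ^ 1 * (1 / sqrtTwo) ∈ _
      have h0 := sqrtTwo_ne_zero
      rw [show sqrtTwo ^ 1 * (1 / sqrtTwo) = 1 by field_simp]
      exact one_mem _
    · exact ⟨0, by simpa using I_mem_ringZ⟩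
  | algebraMap r => exact ⟨0, by simp⟩
  | add x y _ _ hx hy =>
    obtain ⟨k, hk⟩ := hx
    obtain ⟨l, hl⟩ := hy
    refine ⟨k + l, ?_⟩
    rw [show sqrtTwo ^ (k + l) * (x + y) = sqrtTwo ^ l * (sqrtTwo ^ k * x)
      + sqrtTwo ^ k * (sqrtTwo ^ l * y) by ring]
    exact add_mem (mul_mem (pow_mem sqrtTwo_mem_ringZ _) hk)
      (mul_mem (pow_mem sqrtTwo_mem_ringZ _) hl)
  | mul x y _ _ hx hy =>
    obtain ⟨k, hk⟩ := hx
    obtain ⟨l, hl⟩ := hy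
    refine ⟨k + l, ?_⟩
    rw [show sqrtTwo ^ (k + l) * (x * y) = sqrtTwo ^ k * x * (sqrtTwo ^ l * y) by ring]
    exact mul_mem hk hl

lemma omega_mem_ringD : omega ∈ ringD := by
  have h : omega = (1 + Complex.I) * (1 / sqrtTwo) := by
    have h0 := sqrtTwo_ne_zero
    rw [← sqrtTwo_mul_omega]
    field_simp
  rw [h]
  exact mul_mem (add_mem (one_mem _) (Algebra.subset_adjoin (by simp)))
    (Algebra.subset_adjoin (by simp [sqrtTwo]))

/-! ### Residues -/

/-- The parities of the two integer coefficients of the squared modulus detect `IsOdd` and `IsHalf`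
respectively. -/
lemma cyc_mul_star (a b c d : ℤ) : cyc a b c d * star (cyc a b c d) =
    (a ^ 2 + b ^ 2 + c ^ 2 + d ^ 2 : ℤ) + (a * b + b * c + c * d - d * a : ℤ) * sqrtTwo := by
  have h : star (cyc a b c d) = cyc a (-d) (-c) (-b) := by
    have hi : ∀ m : ℤ, star (m : ℂ) = m := fun m => by simp
    simp only [cyc, star_add, star_mul', star_pow, star_omega, hi]
    push_cast
    linear_combination (c * omega ^ 2 - d * omega * (omega ^ 4 - 1)) * omega_pow_four
  rw [h, cyc_mul, sqrtTwo_eq]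
  simp only [cyc]
  push_cast
  ring

lemma dotProduct_star_cyc {ι : Type*} [Fintype ι] (a b c d : ι → ℤ) :
    (fun z => cyc (a z) (b z) (c z) (d z)) ⬝ᵥ star (fun z => cyc (a z) (b z) (c z) (d z)) =
      ((∑ z, (a z ^ 2 + b z ^ 2 + c z ^ 2 + d z ^ 2) : ℤ) : ℂ) +
        (∑ z, (a z * b z + b z * c z + c z * d z - d z * a z) : ℤ) * sqrtTwo := by
  rw [dotProduct]
  push_cast
  rw [Finset.sum_mul, ← Finset.sum_add_distrib]
  refine Finset.sum_congr rfl fun z _ => ?_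
  rw [Pi.star_apply, cyc_mul_star]
  push_cast
  rfl

lemma int_add_mul_sqrtTwo {A B N : ℤ} (h : (A : ℂ) + B * sqrtTwo = N) : A = N ∧ B = 0 := by
  have hr : (A : ℝ) + B * Real.sqrt 2 = N := by
    apply Complex.ofReal_injective
    push_cast
    exact h
  have hB : B = 0 := by
    by_contra hB
    have hB' : (B : ℝ) ≠ 0 := by exact_mod_cast hB
    refine (irrational_iff_ne_rational _).1 irrational_sqrt_two (N - A) B hB ?_
    push_cast
    field_simp
    linarith
  subst hB
  simp at hr
  exact ⟨hr, rfl⟩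

/-- Elements of `ℤ[ω]` of odd norm. -/
def IsOdd (z : ℂ) : Prop := ∃ a b c d, z = cyc a b c d ∧ Odd (a + b + c + d)

/-- Elements of `ℤ[ω]` that are divisible by `1 + ω`, but not by `√2`. -/
def IsHalf (z : ℂ) : Prop := ∃ a b c d, z = cyc a b c d ∧ Odd (a + c) ∧ Odd (b + d)

lemma odd_sum_sq (a b c d : ℤ) : Odd (a ^ 2 + b ^ 2 + c ^ 2 + d ^ 2) ↔ Odd (a + b + c + d) := by
  simp only [Int.odd_add, Int.odd_pow' two_ne_zero, Int.even_pow' two_ne_zero]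

lemma odd_cross_sum (a b c d : ℤ) :
    Odd (a * b + b * c + c * d - d * a) ↔ Odd (a + c) ∧ Odd (b + d) := by
  rw [← Int.odd_mul, show a * b + b * c + c * d - d * a = (a + c) * (b + d) - 2 * (d * a) by ring,
    Int.odd_sub]
  simp

lemma IsOdd.ne_zero {z : ℂ} (h : IsOdd z) : z ≠ 0 := by
  obtain ⟨a, b, c, d, rfl, h⟩ := h
  intro h0
  have hz := cyc_mul_star a b c d
  rw [h0, zero_mul, ← Int.cast_zero] at hz
  have := (int_add_mul_sqrtTwo hz.symm).1
  rw [← odd_sum_sq, this] at h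
  simp at h

lemma IsHalf.ne_zero {z : ℂ} (h : IsHalf z) : z ≠ 0 := by
  obtain ⟨a, b, c, d, rfl, h⟩ := h
  intro h0
  have hz := cyc_mul_star a b c d
  rw [h0, zero_mul, ← Int.cast_zero] at hz
  have := (int_add_mul_sqrtTwo hz.symm).2
  rw [← odd_cross_sum, this] at h
  simp at h

lemma IsHalf.omega_mul {z : ℂ} (h : IsHalf z) : IsHalf (omega * z) := by
  obtain ⟨a, b, c, d, rfl, h1, h2⟩ := h
  refine ⟨_, _, _, _, omega_mul_cyc a b c d, ?_, h1⟩
  rw [Int.odd_iff] at *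
  omega

lemma IsHalf.omega_pow_mul {z : ℂ} (h : IsHalf z) (k : ℕ) : IsHalf (omega ^ k * z) := by
  induction k with
  | zero => simpa using h
  | succ k ih => rw [pow_succ', mul_assoc]; exact ih.omega_mul

lemma IsHalf.mem {z : ℂ} (h : IsHalf z) : z ∈ ringZ := by
  obtain ⟨a, b, c, d, rfl, -⟩ := h
  exact ⟨a, b, c, d, rfl⟩

lemma IsOdd.mem {z : ℂ} (h : IsOdd z) : z ∈ ringZ := by
  obtain ⟨a, b, c, d, rfl, -⟩ := h
  exact ⟨a, b, c, d, rfl⟩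

/-- The hypotheses are the coordinates of `sqrtTwo * cyc p q r s`. Solving them needs only that `a +
c` and `b + d` be even, which is the criterion for divisibility by `√2`. -/
lemma cyc_div_sqrtTwo {a b c d p q r s : ℤ} (h1 : q - s = a) (h2 : p + r = b) (h3 : q + s = c)
    (h4 : r - p = d) : cyc a b c d / sqrtTwo = cyc p q r s := by
  rw [div_eq_iff sqrtTwo_ne_zero, mul_comm, sqrtTwo_mul_cyc, h1, h2, h3, h4]

lemma cyc_div_sqrtTwo_mem {a b c d : ℤ} (h1 : Even (a + c)) (h2 : Even (b + d)) :
    cyc a b c d / sqrtTwo ∈ ringZ := by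
  rw [Int.even_iff] at *
  exact ⟨_, _, _, _, cyc_div_sqrtTwo (p := (b - d) / 2) (q := (a + c) / 2) (r := (b + d) / 2)
    (s := (c - a) / 2) (by omega) (by omega) (by omega) (by omega)⟩

lemma isHalf_cyc_div_sqrtTwo {a b c d : ℤ} (h1 : Odd a) (h2 : Odd b) (h3 : Odd c) (h4 : Odd d) :
    IsHalf (cyc a b c d / sqrtTwo) := by
  rw [Int.odd_iff] at *
  refine ⟨_, _, _, _, cyc_div_sqrtTwo (p := (b - d) / 2) (q := (a + c) / 2) (r := (b + d) / 2)
    (s := (c - a) / 2) (by omega) (by omega) (by omega) (by omega), ?_, ?_⟩ <;>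
  rw [Int.odd_iff] <;> omega

lemma cyc_div_two_mem {a b c d : ℤ} (h1 : Even a) (h2 : Even b) (h3 : Even c) (h4 : Even d) :
    cyc a b c d / 2 ∈ ringZ := by
  obtain ⟨a, rfl⟩ := h1
  obtain ⟨b, rfl⟩ := h2
  obtain ⟨c, rfl⟩ := h3
  obtain ⟨d, rfl⟩ := h4
  refine ⟨a, b, c, d, ?_⟩
  rw [← cyc_add]
  ring

/-- Multiplication by `ω` permutes the coordinates modulo two. -/
lemma exists_omega_pow_mul_cyc (m : Fin 4) (y : Fin 4 → ℤ) : ∃ y' : Fin 4 → ℤ,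
    omega ^ (m : ℕ) * cyc (y 0) (y 1) (y 2) (y 3) = cyc (y' 0) (y' 1) (y' 2) (y' 3) ∧
      ∀ i, (y' i : ZMod 2) = y (i - m) := by
  have hn : ∀ a : ZMod 2, -a = a := by decide
  fin_cases m
  · exact ⟨y, by simp, by simp⟩
  · refine ⟨![-y 3, y 0, y 1, y 2], ?_, ?_⟩
    · simp [omega_mul_cyc]
    · intro i; fin_cases i <;> simp [hn] <;> rfl
  · refine ⟨![-y 2, -y 3, y 0, y 1], ?_, ?_⟩
    · simp [pow_succ, mul_assoc, omega_mul_cyc]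
    · intro i; fin_cases i <;> simp [hn] <;> rfl
  · refine ⟨![-y 1, -y 2, -y 3, y 0], ?_, ?_⟩
    · simp [pow_succ, mul_assoc, omega_mul_cyc]
    · intro i; fin_cases i <;> simp [hn] <;> rfl

/-- The four half residues are the cyclic shifts of `1100`, a single orbit. -/
lemma exists_rotation_of_half : ∀ x y : Fin 4 → ZMod 2, x 0 + x 2 = 1 → x 1 + x 3 = 1 →
    y 0 + y 2 = 1 → y 1 + y 3 = 1 → ∃ m : Fin 4, ∀ i, x i + y (i - m) = 0 := by
  decide

/-- The odd residues form two orbits, of weight 1 and weight 3, which complementation exchanges. -/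
lemma exists_rotation_of_odd : ∀ x y : Fin 4 → ZMod 2, x 0 + x 1 + x 2 + x 3 = 1 →
    y 0 + y 1 + y 2 + y 3 = 1 →
    ∃ m : Fin 4, (∀ i, x i + y (i - m) = 0) ∨ ∀ i, x i + y (i - m) = 1 := by
  decide

lemma zmod_two_eq_one {a : ℤ} : (a : ZMod 2) = 1 ↔ Odd a := ZMod.intCast_eq_one_iff_odd

lemma zmod_two_eq_zero {a : ℤ} : (a : ZMod 2) = 0 ↔ Even a := ZMod.intCast_eq_zero_iff_even

lemma IsHalf.exists_pair {x y : ℂ} (hx : IsHalf x) (hy : IsHalf y) :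
    ∃ m : ℕ, (x + omega ^ m * y) / 2 ∈ ringZ := by
  obtain ⟨a, b, c, d, rfl, h1, h2⟩ := hx
  obtain ⟨a', b', c', d', rfl, h3, h4⟩ := hy
  rw [← zmod_two_eq_one] at *
  push_cast at *
  obtain ⟨m, hm⟩ := exists_rotation_of_half ![a, b, c, d] (fun i => (![a', b', c', d'] i : ℤ))
    (by simpa using h1) (by simpa using h2) (by simpa using h3) (by simpa using h4)
  obtain ⟨y', hy', he⟩ := exists_omega_pow_mul_cyc m ![a', b', c', d']
  simp only [← he] at hm
  refine ⟨m, ?_⟩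
  simp only [Matrix.cons_val] at hy'
  rw [hy', cyc_add]
  refine cyc_div_two_mem ?_ ?_ ?_ ?_ <;> rw [← zmod_two_eq_zero] <;> push_cast
  exacts [hm 0, hm 1, hm 2, hm 3]

lemma IsOdd.exists_pair {x y : ℂ} (hx : IsOdd x) (hy : IsOdd y) :
    ∃ m : ℕ, (x + omega ^ m * y) / 2 ∈ ringZ ∨
      IsHalf ((x + omega ^ m * y) / sqrtTwo) ∧ IsHalf ((x - omega ^ m * y) / sqrtTwo) := by
  obtain ⟨a, b, c, d, rfl, h1⟩ := hx
  obtain ⟨a', b', c', d', rfl, h3⟩ := hy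
  rw [← zmod_two_eq_one] at *
  push_cast at *
  obtain ⟨m, hm⟩ := exists_rotation_of_odd ![a, b, c, d] (fun i => (![a', b', c', d'] i : ℤ))
    (by simpa using h1) (by simpa using h3)
  obtain ⟨y', hy', he⟩ := exists_omega_pow_mul_cyc m ![a', b', c', d']
  simp only [← he] at hm
  refine ⟨m, ?_⟩
  simp only [Matrix.cons_val] at hy'
  rw [hy', sub_eq_add_neg, cyc_neg, cyc_add, cyc_add]
  have hn : ∀ a : ZMod 2, -a = a := by decide
  refine hm.imp (fun hm => ?_) fun hm => ⟨?_, ?_⟩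
  · refine cyc_div_two_mem ?_ ?_ ?_ ?_ <;> rw [← zmod_two_eq_zero] <;> push_cast
    exacts [hm 0, hm 1, hm 2, hm 3]
  · refine isHalf_cyc_div_sqrtTwo ?_ ?_ ?_ ?_ <;> rw [← zmod_two_eq_one] <;> push_cast
    exacts [hm 0, hm 1, hm 2, hm 3]
  · refine isHalf_cyc_div_sqrtTwo ?_ ?_ ?_ ?_ <;> rw [← zmod_two_eq_one] <;> push_cast <;> rw [hn]
    exacts [hm 0, hm 1, hm 2, hm 3]

lemma exists_ne_odd_of_even_sum {ι : Type*} [Fintype ι] {f : ι → ℤ} (h : Even (∑ i, f i))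
    {x : ι} (hx : Odd (f x)) : ∃ y, y ≠ x ∧ Odd (f y) := by
  classical
  by_contra! hy
  have h2 : Even (∑ i ∈ Finset.univ.erase x, f i) :=
    Finset.even_sum _ fun i hi => Int.not_odd_iff_even.1 (hy i (Finset.ne_of_mem_erase hi))
  rw [← Finset.add_sum_erase _ _ (Finset.mem_univ x)] at h
  exact Int.not_even_iff_odd.2 (hx.add_even h2) h

/-- If the squared norm of a vector over `ℤ[ω]` is even, the entries that are not divisible by
`√2` can be paired with entries of the same kind. -/
lemma exists_pair_of_not_div {ι : Type*} [Fintype ι] {v : ι → ℂ} (hv : ∀ z, v z ∈ ringZ) {N : ℤ}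
    (hN : Even N) (h : v ⬝ᵥ star v = N) {x : ι} (hx : v x / sqrtTwo ∉ ringZ) :
    ∃ y, y ≠ x ∧ (IsOdd (v x) ∧ IsOdd (v y) ∨ IsHalf (v x) ∧ IsHalf (v y)) := by
  choose a b c d hv using hv
  rw [show v = fun z => cyc (a z) (b z) (c z) (d z) from funext hv, dotProduct_star_cyc] at h
  obtain ⟨hA, hB⟩ := int_add_mul_sqrtTwo h
  by_cases hodd : Odd (a x + b x + c x + d x)
  · have hp := fun z => odd_sum_sq (a z) (b z) (c z) (d z)
    obtain ⟨y, hy, hy'⟩ := exists_ne_odd_of_even_sum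
      (f := fun z => a z ^ 2 + b z ^ 2 + c z ^ 2 + d z ^ 2) (hA ▸ hN) ((hp x).2 hodd)
    exact ⟨y, hy, Or.inl ⟨⟨_, _, _, _, hv x, hodd⟩, ⟨_, _, _, _, hv y, (hp y).1 hy'⟩⟩⟩
  · have hp := fun z => odd_cross_sum (a z) (b z) (c z) (d z)
    -- With an even total, `a + c` and `b + d` have the same parity; if both were even, `√2` would
    -- divide `v x`.
    have hxo : Odd (a x + c x) ∧ Odd (b x + d x) := by
      by_contra hne
      refine hx ?_
      rw [hv x]
      rw [Int.odd_iff, Int.odd_iff] at hne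
      rw [Int.odd_iff] at hodd
      refine cyc_div_sqrtTwo_mem ?_ ?_ <;> rw [Int.even_iff] <;> omega
    obtain ⟨y, hy, hy'⟩ := exists_ne_odd_of_even_sum
      (f := fun z => a z * b z + b z * c z + c z * d z - d z * a z) (hB ▸ Even.zero) ((hp x).2 hxo)
    exact ⟨y, hy, Or.inr ⟨⟨_, _, _, _, hv x, hxo⟩, ⟨_, _, _, _, hv y, (hp y).1 hy'⟩⟩⟩

/-- A unit vector over `ℤ[ω]` is a power of `ω` times a basis vector. -/
lemma exists_eq_single_of_unit {ι : Type*} [Fintype ι] [DecidableEq ι] {v : ι → ℂ}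
    (hv : ∀ z, v z ∈ ringZ) (h : v ⬝ᵥ star v = 1) :
    ∃ x, ∃ k : ℕ, v = Pi.single x (omega ^ k) := by
  choose a b c d hv using hv
  rw [show v = fun z => cyc (a z) (b z) (c z) (d z) from funext hv, dotProduct_star_cyc,
    ← Int.cast_one] at h
  obtain ⟨hA, -⟩ := int_add_mul_sqrtTwo h
  have hx : ∃ x, a x ^ 2 + b x ^ 2 + c x ^ 2 + d x ^ 2 ≠ 0 := by
    by_contra! hne
    simp [hne] at hA
  obtain ⟨x, hx⟩ := hx
  have hrest : 0 ≤ ∑ z ∈ Finset.univ.erase x, (a z ^ 2 + b z ^ 2 + c z ^ 2 + d z ^ 2) :=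
    Finset.sum_nonneg fun z _ => by positivity
  have hpos : 0 ≤ a x ^ 2 + b x ^ 2 + c x ^ 2 + d x ^ 2 := by positivity
  rw [← Finset.add_sum_erase _ _ (Finset.mem_univ x)] at hA
  have h1 : a x ^ 2 + b x ^ 2 + c x ^ 2 + d x ^ 2 = 1 := by omega
  have h0 : ∀ z, z ≠ x → v z = 0 := by
    intro z hz
    have hz0 := (Finset.sum_eq_zero_iff_of_nonneg (fun z _ => by positivity)).1
      (show ∑ z ∈ Finset.univ.erase x, (a z ^ 2 + b z ^ 2 + c z ^ 2 + d z ^ 2) = 0 by omega) z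
      (by simp [hz])
    have h4 : a z = 0 ∧ b z = 0 ∧ c z = 0 ∧ d z = 0 := by
      have := sq_nonneg (a z)
      have := sq_nonneg (b z)
      have := sq_nonneg (c z)
      have := sq_nonneg (d z)
      refine ⟨?_, ?_, ?_, ?_⟩ <;> refine pow_eq_zero_iff two_ne_zero |>.1 ?_ <;> omega
    obtain ⟨ha, hb, hc, hd⟩ := h4
    rw [hv z, ha, hb, hc, hd]
    simp [cyc]
  have hk : ∃ k : ℕ, v x = omega ^ k := by
    rw [hv x]
    generalize a x = a at h1
    generalize b x = b at h1
    generalize c x = c at h1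
    generalize d x = d at h1
    have e4 := omega_pow_four
    have ha : -1 ≤ a ∧ a ≤ 1 := by constructor <;> nlinarith [sq_nonneg b, sq_nonneg c, sq_nonneg d]
    have hb : -1 ≤ b ∧ b ≤ 1 := by constructor <;> nlinarith [sq_nonneg a, sq_nonneg c, sq_nonneg d]
    have hc : -1 ≤ c ∧ c ≤ 1 := by constructor <;> nlinarith [sq_nonneg b, sq_nonneg a, sq_nonneg d]
    have hd : -1 ≤ d ∧ d ≤ 1 := by constructor <;> nlinarith [sq_nonneg b, sq_nonneg c, sq_nonneg a]
    have key : ∀ a ∈ Finset.Icc (-1 : ℤ) 1, ∀ b ∈ Finset.Icc (-1 : ℤ) 1,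
        ∀ c ∈ Finset.Icc (-1 : ℤ) 1, ∀ d ∈ Finset.Icc (-1 : ℤ) 1,
        a ^ 2 + b ^ 2 + c ^ 2 + d ^ 2 = 1 → (a, b, c, d) ∈ [((1 : ℤ), (0 : ℤ), (0 : ℤ), (0 : ℤ)),
          (0, 1, 0, 0), (0, 0, 1, 0), (0, 0, 0, 1), (-1, 0, 0, 0), (0, -1, 0, 0), (0, 0, -1, 0),
          (0, 0, 0, -1)] := by decide
    have := key a (Finset.mem_Icc.2 ha) b (Finset.mem_Icc.2 hb) c (Finset.mem_Icc.2 hc) d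
      (Finset.mem_Icc.2 hd) h1
    simp only [List.mem_cons, Prod.mk.injEq, List.not_mem_nil, or_false] at this
    rcases this with h | h | h | h | h | h | h | h <;> obtain ⟨rfl, rfl, rfl, rfl⟩ := h
    · exact ⟨0, by simp [cyc]⟩
    · exact ⟨1, by simp [cyc]⟩
    · exact ⟨2, by simp [cyc]⟩
    · exact ⟨3, by simp [cyc]⟩
    · exact ⟨4, by simp [cyc, e4]⟩
    · exact ⟨5, by simp [cyc, pow_succ _ 4, e4]⟩
    · exact ⟨6, by simp [cyc, pow_add _ 4 2, e4]⟩
    · exact ⟨7, by simp [cyc, pow_add _ 4 3, e4]⟩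
  obtain ⟨k, hk⟩ := hk
  refine ⟨x, k, funext fun z => ?_⟩
  by_cases hz : z = x
  · subst hz; simp [hk]
  · simp [hz, h0 z hz]

section

/-! ### Column reduction -/

variable {n : ℕ}

/-- There is a representable operator of determinant one that maps `v` to `w` and acts trivially
on the coordinates outside `s`. -/
def Reaches (s : Finset (Bits n)) (v w : Bits n → ℂ) : Prop :=
  ∃ M : Operator n, IsRepresentable M ∧ M.det = 1 ∧ M *ᵥ v = w ∧
    (∀ u, ∀ x ∉ s, (M *ᵥ u) x = u x) ∧ ∀ x ∉ s, M *ᵥ Pi.single x 1 = Pi.single x 1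

namespace Reaches

variable {s : Finset (Bits n)} {u v w : Bits n → ℂ}

lemma refl : Reaches s v v :=
  ⟨1, isRepresentable_one, det_one, one_mulVec v, fun _ _ _ => by rw [one_mulVec],
    fun _ _ => one_mulVec _⟩

lemma trans (h : Reaches s u v) (h' : Reaches s v w) : Reaches s u w := by
  obtain ⟨M, hM, hd, rfl, hf, hs⟩ := h
  obtain ⟨M', hM', hd', rfl, hf', hs'⟩ := h'
  refine ⟨M' * M, hM'.mul hM, by rw [det_mul, hd, hd', one_mul], (mulVec_mulVec ..).symm,
    fun u x hx => ?_, fun x hx => ?_⟩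
  · rw [← mulVec_mulVec, hf' _ x hx, hf _ x hx]
  · rw [← mulVec_mulVec, hs x hx, hs' x hx]

lemma smul (c : ℂ) (h : Reaches s v w) : Reaches s (c • v) (c • w) := by
  obtain ⟨M, hM, hd, rfl, hf, hs⟩ := h
  exact ⟨M, hM, hd, mulVec_smul M c v, hf, hs⟩

lemma apply_eq (h : Reaches s v w) {x : Bits n} (hx : x ∉ s) : w x = v x := by
  obtain ⟨M, -, -, rfl, hf, -⟩ := h
  exact hf v x hx

lemma dotProduct_star (h : Reaches s v w) : w ⬝ᵥ star w = v ⬝ᵥ star v := by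
  obtain ⟨M, hM, -, rfl, -, -⟩ := h
  rw [star_mulVec, dotProduct_comm, ← dotProduct_mulVec, mulVec_mulVec,
    ← star_eq_conjTranspose, mem_unitaryGroup_iff'.1 hM.mem_unitaryGroup, one_mulVec,
    dotProduct_comm]

end Reaches

lemma FullyControllable.reaches {g : Matrix (Fin 2) (Fin 2) ℂ} (hg : FullyControllable g)
    {s : Finset (Bits n)} {x y : Bits n} (hxy : x ≠ y) (hx : x ∈ s) (hy : y ∈ s)
    (v : Bits n → ℂ) : Reaches s v (twoLevel g x y v) := by
  obtain ⟨M, hM, hd, hf⟩ := hg.realizable hxy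
  have key : ∀ u, ∀ z ∉ s, (M *ᵥ u) z = u z := fun u z hz => by
    rw [hf, twoLevel, if_neg (ne_of_mem_of_not_mem hx hz).symm,
      if_neg (ne_of_mem_of_not_mem hy hz).symm]
  refine ⟨M, hM, hd, hf v, key, fun z hz => ?_⟩
  have hxz := ne_of_mem_of_not_mem hx hz
  have hyz := ne_of_mem_of_not_mem hy hz
  rw [hf]
  ext t
  by_cases h1 : t = x
  · simp [twoLevel, h1, hxz, hyz]
  · by_cases h2 : t = y
    · simp [twoLevel, h2, hxz, hyz]
    · simp [twoLevel, h1, h2]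

lemma matT_pow (m : ℕ) : matT ^ m = !![1, 0; 0, omega ^ m] := by
  have h : ∀ a : ℂ, !![1, 0; 0, a] = Matrix.diagonal ![1, a] := by
    intro a
    ext i j
    fin_cases i <;> fin_cases j <;> simp
  rw [matT, h, h, Matrix.diagonal_pow]
  congr 1
  ext i
  fin_cases i <;> simp

/-- The Hadamard-type reduction of a pair of entries. -/
lemma reaches_hadamard {s : Finset (Bits n)} {x y : Bits n} (hxy : x ≠ y) (hx : x ∈ s)
    (hy : y ∈ s) (v : Bits n → ℂ) (m : ℕ) : ∃ w, Reaches s v w ∧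
      w x = Complex.I * ((v x + omega ^ m * v y) / sqrtTwo) ∧
      w y = Complex.I * star omega ^ m * ((v x - omega ^ m * v y) / sqrtTwo) ∧
      ∀ z, z ≠ x → z ≠ y → w z = v z := by
  refine ⟨_, (fullyControllable_I_smul_matH.conj_matT_pow m).reaches hxy hx hy v, ?_, ?_, ?_⟩
  · rw [← star_pow, matT_pow, matH_eq, star_eq_conjTranspose]
    simp [twoLevel, Matrix.mul_apply, Fin.sum_univ_two]
    ring
  · rw [← star_pow, matT_pow, matH_eq, star_eq_conjTranspose]
    simp [twoLevel, Matrix.mul_apply, Fin.sum_univ_two, hxy.symm]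
    ring
  · intro z h1 h2
    simp [twoLevel, h1, h2]

lemma star_omega_eq_pow : star omega = omega ^ 7 := by
  rw [star_omega]; linear_combination -omega ^ 3 * omega_pow_four

/-- The sum and the difference of `v x` and `ω ^ m * v y` differ by twice an element of `ℤ[ω]`, so
both are divisible by 2. Dividing by `√2` leaves a factor `√2` in each. -/
lemma reaches_of_add_div_two_mem {s : Finset (Bits n)} {x y : Bits n} (hxy : x ≠ y) (hx : x ∈ s)
    (hy : y ∈ s) {v : Bits n → ℂ} (hv : v y ∈ ringZ) {m : ℕ}
    (h : (v x + omega ^ m * v y) / 2 ∈ ringZ) : ∃ w, Reaches s v w ∧ w x / sqrtTwo ∈ ringZ ∧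
      w y / sqrtTwo ∈ ringZ ∧ ∀ z, z ≠ x → z ≠ y → w z = v z := by
  obtain ⟨w, hw, h1, h2, h3⟩ := reaches_hadamard hxy hx hy v m
  have hdiv : ∀ a : ℂ, a / sqrtTwo / sqrtTwo = a / 2 := fun a => by
    rw [div_div, sqrtTwo_mul_self]
  refine ⟨w, hw, ?_, ?_, h3⟩
  · rw [h1, mul_div_assoc, hdiv]
    exact mul_mem I_mem_ringZ h
  · rw [h2, mul_div_assoc, hdiv, show (v x - omega ^ m * v y) / 2 =
      (v x + omega ^ m * v y) / 2 - omega ^ m * v y by ring]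
    exact mul_mem (mul_mem I_mem_ringZ (pow_mem star_omega_mem_ringZ m))
      (sub_mem h (mul_mem (pow_mem omega_mem_ringZ m) hv))

lemma reaches_pair {s : Finset (Bits n)} {x y : Bits n} (hxy : x ≠ y) (hx : x ∈ s)
    (hy : y ∈ s) {v : Bits n → ℂ}
    (h : IsOdd (v x) ∧ IsOdd (v y) ∨ IsHalf (v x) ∧ IsHalf (v y)) :
    ∃ w, Reaches s v w ∧ w x / sqrtTwo ∈ ringZ ∧ w y / sqrtTwo ∈ ringZ ∧
      ∀ z, z ≠ x → z ≠ y → w z = v z := by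
  have hhalf : ∀ v : Bits n → ℂ, IsHalf (v x) → IsHalf (v y) → ∃ w, Reaches s v w ∧
      w x / sqrtTwo ∈ ringZ ∧ w y / sqrtTwo ∈ ringZ ∧ ∀ z, z ≠ x → z ≠ y → w z = v z := by
    intro v h1 h2
    obtain ⟨m, hm⟩ := h1.exists_pair h2
    exact reaches_of_add_div_two_mem hxy hx hy h2.mem hm
  rcases h with ⟨h1, h2⟩ | ⟨h1, h2⟩
  · obtain ⟨m, hm | ⟨hm, hm'⟩⟩ := h1.exists_pair h2
    · exact reaches_of_add_div_two_mem hxy hx hy h2.mem hm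
    -- For odd residues in different orbits, the first Hadamard only yields two half entries; a
    -- second one then gains the factor `√2`. The prefactors are powers of `ω` and preserve
    -- `IsHalf`.
    · obtain ⟨w, hw, hwx, hwy, hwz⟩ := reaches_hadamard hxy hx hy v m
      obtain ⟨w', hw', h1', h2', h3'⟩ := hhalf w
        (by rw [hwx, ← omega_mul_self, ← pow_two]; exact hm.omega_pow_mul 2)
        (by
          rw [hwy, ← omega_mul_self, ← pow_two, star_omega_eq_pow, ← pow_mul, ← pow_add]
          exact hm'.omega_pow_mul _)
      exact ⟨w', hw.trans hw', h1', h2', fun z hzx hzy => by rw [h3' z hzx hzy, hwz z hzx hzy]⟩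
  · exact hhalf v h1 h2

lemma mem_ringZ_of_div {z : ℂ} (h : z / sqrtTwo ∈ ringZ) : z ∈ ringZ := by
  rw [← div_mul_cancel₀ z sqrtTwo_ne_zero]
  exact mul_mem h sqrtTwo_mem_ringZ

lemma exists_reaches_div_sqrtTwo {s : Finset (Bits n)} {v : Bits n → ℂ}
    (hv : ∀ z, v z ∈ ringZ) {N : ℤ} (hN : Even N) (h : v ⬝ᵥ star v = N)
    (hs : ∀ z ∉ s, v z = 0) : ∃ w, Reaches s v w ∧ ∀ z, w z / sqrtTwo ∈ ringZ := by
  classical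
  -- Treating a pair strictly lowers the number of entries not divisible by `√2`, and keeps the
  -- norm, so a partner always exists.
  induction hk : (Finset.univ.filter fun z => v z / sqrtTwo ∉ ringZ).card using
    Nat.strong_induction_on generalizing v with
  | _ k ih =>
    by_cases hall : ∀ z, v z / sqrtTwo ∈ ringZ
    · exact ⟨v, .refl, hall⟩
    push Not at hall
    obtain ⟨x, hx⟩ := hall
    obtain ⟨y, hyx, hty⟩ := exists_pair_of_not_div hv hN h hx
    have hxs : x ∈ s := by
      by_contra hxs
      exact hx (by simp [hs x hxs, zero_mem])
    have hys : y ∈ s := by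
      by_contra hys
      rcases hty with h | h
      exacts [h.2.ne_zero (hs y hys), h.2.ne_zero (hs y hys)]
    obtain ⟨w, hw, hwx, hwy, hwz⟩ := reaches_pair hyx.symm hxs hys hty
    have hcard : (Finset.univ.filter fun z => w z / sqrtTwo ∉ ringZ).card < k := by
      rw [← hk]
      refine Finset.card_lt_card (Finset.ssubset_iff_of_subset ?_ |>.2 ⟨x, by simpa using hx,
        by simpa using hwx⟩)
      intro z
      by_cases h1 : z = x
      · simp [h1, hwx]
      by_cases h2 : z = y
      · simp [h2, hwy]
      simp [hwz z h1 h2]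
    have hwR : ∀ z, w z ∈ ringZ := by
      intro z
      by_cases h1 : z = x
      · exact h1 ▸ mem_ringZ_of_div hwx
      by_cases h2 : z = y
      · exact h2 ▸ mem_ringZ_of_div hwy
      rw [hwz z h1 h2]
      exact hv z
    obtain ⟨w', hw', hdiv⟩ := ih _ hcard hwR (by rw [hw.dotProduct_star, h])
      (fun z hz => by rw [hw.apply_eq hz, hs z hz]) rfl
    exact ⟨w', hw.trans hw', hdiv⟩

lemma reaches_single_of_mem {s : Finset (Bits n)} {j l : Bits n} (hj : j ∈ s) (hl : l ∈ s)
    (hjl : j ≠ l) (k : ℕ) : Reaches s (Pi.single j (omega ^ k)) (Pi.single j 1) := by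
  -- The opposite phase falls on the coordinate `l`, where the vector vanishes. This is why `s` must
  -- contain a second element.
  have := (fullyControllable_matW.pow k).reaches hjl hj hl (Pi.single j (omega ^ k))
  convert this
  have hW : matW = Matrix.diagonal ![star omega, omega] := by
    unfold matW
    ext i j
    fin_cases i <;> fin_cases j <;> simp
  have h1 : star omega ^ k * omega ^ k = 1 := by rw [← mul_pow, star_omega_mul, one_pow]
  rw [hW, Matrix.diagonal_pow]
  ext z
  by_cases hzj : z = j
  · subst hzj
    simpa [twoLevel, hjl.symm] using h1.symm
  · by_cases hzl : z = l
    · simp [twoLevel, hzl, hjl.symm]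
    · simp [twoLevel, hzl, hzj]

lemma reaches_single {s : Finset (Bits n)} {j l : Bits n} (hj : j ∈ s) (hl : l ∈ s)
    (hjl : j ≠ l) {v : Bits n → ℂ} (hv : ∀ z, v z ∈ ringZ) (h : v ⬝ᵥ star v = 1)
    (hs : ∀ z ∉ s, v z = 0) : Reaches s v (Pi.single j 1) := by
  obtain ⟨x, k, rfl⟩ := exists_eq_single_of_unit hv h
  by_cases hxj : x = j
  · subst hxj
    exact reaches_single_of_mem hj hl hjl k
  have hx : x ∈ s := by
    by_contra hx
    have := hs x hx
    have h0 : omega ≠ 0 := fun h => by simpa [h] using omega_pow_four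
    simp [h0] at this
  refine (fullyControllable_matIX.reaches (Ne.symm hxj) hj hx _).trans ?_
  -- Moving the entry with `iX` costs a factor `i = ω²`.
  convert reaches_single_of_mem hj hl hjl (k + 2) using 1
  ext z
  by_cases hzj : z = j
  · subst hzj
    simp [twoLevel, matIX, Ne.symm hxj, pow_add, pow_two, omega_mul_self, mul_comm]
  · by_cases hzx : z = x
    · simp [twoLevel, matIX, hzx, hxj, Ne.symm hxj]
    · simp [twoLevel, hzx, hzj]

/-- Every unit vector over `ℤ[1/√2, i]` supported on a set with at least two elements can be
mapped to any of the basis vectors of that set. -/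
theorem reaches_single_of_pow {s : Finset (Bits n)} {j l : Bits n} (hj : j ∈ s) (hl : l ∈ s)
    (hjl : j ≠ l) (k : ℕ) {v : Bits n → ℂ} (hv : ∀ z, sqrtTwo ^ k * v z ∈ ringZ)
    (h : v ⬝ᵥ star v = 1) (hs : ∀ z ∉ s, v z = 0) : Reaches s v (Pi.single j 1) := by
  induction k generalizing v with
  | zero => exact reaches_single hj hl hjl (by simpa using hv) h hs
  | succ k ih =>
    have h0 := sqrtTwo_ne_zero
    obtain ⟨w, hw, hdiv⟩ := exists_reaches_div_sqrtTwo (s := s) (v := sqrtTwo ^ (k + 1) • v)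
      (N := 2 ^ (k + 1)) hv (by simp [Int.even_pow]) (by
        rw [star_smul, smul_dotProduct, dotProduct_smul, h, star_pow, star_sqrtTwo]
        simp only [smul_eq_mul, mul_one]
        rw [← mul_pow, sqrtTwo_mul_self]
        simp) (fun z hz => by simp [hs z hz])
    have hw' := hw.smul (sqrtTwo ^ (k + 1))⁻¹
    rw [inv_smul_smul₀ (pow_ne_zero _ h0)] at hw'
    refine hw'.trans (ih (fun z => ?_) (by rw [hw'.dotProduct_star, h]) fun z hz => by
      rw [hw'.apply_eq hz, hs z hz])
    convert hdiv z using 1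
    simp only [Pi.smul_apply, smul_eq_mul]
    field_simp
    ring

/-! ### Reduction of unitary operators -/

lemma IsRepresentable.apply_mem {A : Operator n} (hA : IsRepresentable A) (x y : Bits n) :
    A x y ∈ ringD := by
  have hs : (1 / sqrtTwo : ℂ) ∈ ringD := Algebra.subset_adjoin (by simp [sqrtTwo])
  have hI : Complex.I ∈ ringD := Algebra.subset_adjoin (by simp)
  have hmux : ∀ (q : Fin n) (F : Rest q → Matrix (Fin 2) (Fin 2) ℂ),
      (∀ r a b, F r a b ∈ ringD) → ∀ x y, mux q F x y ∈ ringD := by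
    intro q F hF x y
    rw [mux_apply]
    split_ifs
    · exact hF _ _ _
    · exact zero_mem _
  have hone : ∀ {ι : Type} [DecidableEq ι] (a b : ι), (1 : Matrix ι ι ℂ) a b ∈ ringD := by
    intro ι _ a b
    rw [one_apply]
    split_ifs
    exacts [one_mem _, zero_mem _]
  have hgate : ∀ (g : Gate n) x y, g.toOperator x y ∈ ringD := by
    intro g
    cases g with
    | scalar => exact fun x y => mul_mem omega_mem_ringD (hone x y)
    | hadamard q =>
      simp only [Gate.toOperator, onQubit_eq_mux]
      refine hmux q _ fun r a b => ?_
      rw [matH_eq]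
      fin_cases a <;> fin_cases b
      exacts [hs, hs, hs, neg_mem hs]
    | phase q =>
      simp only [Gate.toOperator, onQubit_eq_mux]
      refine hmux q _ fun r a b => ?_
      fin_cases a <;> fin_cases b
      exacts [one_mem _, zero_mem _, zero_mem _, hI]
    | tgate q =>
      simp only [Gate.toOperator, onQubit_eq_mux]
      refine hmux q _ fun r a b => ?_
      fin_cases a <;> fin_cases b
      exacts [one_mem _, zero_mem _, zero_mem _, omega_mem_ringD]
    | cnot c t h =>
      simp only [Gate.toOperator, onQubits_matCNOT_eq_mux h]
      refine hmux t _ fun r a b => ?_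
      split_ifs
      · fin_cases a <;> fin_cases b
        exacts [zero_mem _, one_mem _, one_mem _, zero_mem _]
      · exact hone a b
  obtain ⟨C, rfl⟩ := hA
  induction C generalizing x y with
  | nil => exact hone x y
  | cons g C ih =>
    rw [Circuit.toOperator, mul_apply]
    exact sum_mem fun z _ => mul_mem (ih x z) (hgate g z y)

/-- A basis vector fixed by a unitary is also fixed by its adjoint, so a trivial column forces a
trivial row. -/
lemma apply_eq_of_mulVec_single {ι : Type*} [Fintype ι] [DecidableEq ι] {U : Matrix ι ι ℂ}
    (hU : U ∈ unitaryGroup ι ℂ) {x : ι} (hx : U *ᵥ Pi.single x 1 = Pi.single x 1) (y : ι) :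
    U x y = (1 : Matrix ι ι ℂ) x y := by
  have h : star U *ᵥ Pi.single x 1 = Pi.single x 1 := by
    nth_rw 1 [← hx]
    rw [mulVec_mulVec, mem_unitaryGroup_iff'.1 hU, one_mulVec]
  have h' := congrFun h y
  rw [mulVec_single_one] at h'
  have h2 : star (U x y) = (Pi.single x 1 : ι → ℂ) y := h'
  rw [← star_star (U x y), h2, Pi.single_apply, one_apply]
  simp only [eq_comm (a := y)]
  split_ifs
  exacts [star_one _, star_zero _]

lemma exists_common_pow {v : Bits n → ℂ} (hv : ∀ z, v z ∈ ringD) :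
    ∃ k : ℕ, ∀ z, sqrtTwo ^ k * v z ∈ ringZ := by
  choose k hk using fun z => exists_pow_mul_mem_ringZ (hv z)
  refine ⟨∑ z, k z, fun z => ?_⟩
  rw [← Finset.sum_erase_add _ _ (Finset.mem_univ z), pow_add, mul_assoc]
  exact mul_mem (pow_mem sqrtTwo_mem_ringZ _) (hk z)

/-- A special unitary operator over `ℤ[1/√2, i]` that fixes all basis vectors outside `s` is
representable. -/
theorem isRepresentable_of_fixes (s : Finset (Bits n)) {U : Operator n}
    (hU : U ∈ unitaryGroup (Bits n) ℂ) (hD : ∀ x y, U x y ∈ ringD) (hdet : U.det = 1)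
    (hs : ∀ x ∉ s, U *ᵥ Pi.single x 1 = Pi.single x 1) : IsRepresentable U := by
  induction hk : s.card generalizing s U with
  | zero =>
    rw [Finset.card_eq_zero] at hk
    subst hk
    have : U = 1 := by
      ext x y
      exact apply_eq_of_mulVec_single hU (hs x (by simp)) y
    rw [this]
    exact isRepresentable_one
  | succ k ih =>
    obtain ⟨j, hj⟩ := Finset.card_pos.1 (by omega : 0 < s.card)
    by_cases hl : ∃ l ∈ s, j ≠ l
    · obtain ⟨l, hl, hjl⟩ := hl
      have hcol : ∀ z, (U *ᵥ Pi.single j 1) z = U z j := fun z => by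
        rw [mulVec_single_one]; rfl
      obtain ⟨m, hm⟩ := exists_common_pow (v := U *ᵥ Pi.single j 1) fun z => by
        rw [hcol]; exact hD z j
      have hnorm : (U *ᵥ Pi.single j 1) ⬝ᵥ star (U *ᵥ Pi.single j 1) = 1 := by
        rw [star_mulVec, dotProduct_comm, ← dotProduct_mulVec, mulVec_mulVec,
          ← star_eq_conjTranspose, mem_unitaryGroup_iff'.1 hU, one_mulVec]
        rw [dotProduct_single_one, Pi.star_apply, Pi.single_eq_same, star_one]
      -- The rows outside `s` are trivial, so column `j` is supported on `s`. `M` reduces it without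
      -- disturbing the columns already fixed.
      obtain ⟨M, hM, hMd, hMv, -, hMs⟩ := reaches_single_of_pow hj hl hjl m hm hnorm
        fun z hz => by
          rw [hcol, apply_eq_of_mulVec_single hU (hs z hz), one_apply_ne]
          exact (ne_of_mem_of_not_mem hj hz).symm
      have hMU := hM.mem_unitaryGroup
      have hrep : IsRepresentable (M * U) := by
        refine ih (s.erase j) (mul_mem hMU hU) (fun x y => ?_) (by rw [det_mul, hMd, hdet, one_mul])
          (fun x hx => ?_) (by rw [Finset.card_erase_of_mem hj, hk]; rfl)
        · rw [mul_apply]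
          exact sum_mem fun z _ => mul_mem (hM.apply_mem x z) (hD z y)
        · rw [← mulVec_mulVec]
          by_cases hxj : x = j
          · subst hxj; exact hMv
          · have hxs : x ∉ s := fun h => hx (Finset.mem_erase.2 ⟨hxj, h⟩)
            rw [hs x hxs, hMs x hxs]
      have : U = star M * (M * U) := by
        rw [← Matrix.mul_assoc, mem_unitaryGroup_iff'.1 hMU, Matrix.one_mul]
      rw [this]
      exact hM.star.mul hrep
    -- Here `s = {j}`: no second coordinate can absorb a phase, and the determinant forces the last
    -- diagonal entry to be `1`.
    · push Not at hl
      have hrow : ∀ x, x ≠ j → ∀ y, U x y = (1 : Operator n) x y := fun x hx y =>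
        apply_eq_of_mulVec_single hU (hs x fun h => hx (hl x h).symm) y
      have hcol : ∀ x, x ≠ j → ∀ y, U y x = (1 : Operator n) y x := fun x hx y => by
        have := congrFun (hs x fun h => hx (hl x h).symm) y
        rw [mulVec_single_one] at this
        rw [one_apply, ← Pi.single_apply]
        exact this
      have hdiag : U = Matrix.diagonal fun x => U x x := by
        ext x y
        by_cases hxy : x = y
        · subst hxy; simp
        · rw [diagonal_apply_ne _ hxy]
          by_cases hx : x = j
          · rw [hcol y (fun h => hxy (hx.trans h.symm)), one_apply_ne hxy]
          · rw [hrow x hx, one_apply_ne hxy]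
      have hjj : U j j = 1 := by
        rw [hdiag, det_diagonal, Finset.prod_eq_single j] at hdet
        · exact hdet
        · intro x _ hx
          rw [hrow x hx, one_apply_eq]
        · simp
      have : U = 1 := by
        ext x y
        by_cases hx : x = j
        · by_cases hy : y = j
          · rw [hx, hy, hjj, one_apply_eq]
          · exact hcol y hy x
        · exact hrow x hx y
      rw [this]
      exact isRepresentable_one

end

end CliffordT

end

theorem mainTheorem3 (n : ℕ) (U : CliffordT.Operator n)
    (hunitary : U ∈ Matrix.unitaryGroup (CliffordT.Bits n) ℂ)
    (hentries : ∀ x y, U x y ∈ CliffordT.ringD)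
    (hdet : U.det = 1) :
    CliffordT.IsRepresentable U :=
  CliffordT.isRepresentable_of_fixes Finset.univ hunitary hentries hdet (by simp)
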